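/- Let $d\ge 1$ be a fixed integer and let $\mathcal P,\mathcal Q$ be two fixed probability distributions on $\mathbb R^d$ having bounded continuous densities with respect to Lebesgue measure. Assume moreover that $\mathcal Q$ has mean zero and is sub-Gaussian, i.e. for $\tilde Z\sim\mathcal Q$, $$\sup_{\|v\|_2=1}\ \inf\left\{L>0:\ \mathbb E\left[e^{\langle \tilde Z,v\rangle^2/L^2}\right]\le 2\right\}<\infty .$$ For $n\in\mathbb N$ and $\sigma>0$ let $X_1,\dots,X_n$ be i.i.d. with law $\mathcal P$, let $\tilde Z_1,\dots,\tilde Z_n$ be i.i.d. with law $\mathcal Q$, let $\pi^\star$ be uniformly distributed on the symmetric group $S_n$, all independent, and put $Y_i=X_{\pi^\star(i)}+Z_i$ with $Z_i=\sigma\tilde Z_i$, $1\le i\le n$. An estimator $\hat\pi$ is a measurable map taking $(X_1,\dots,X_n)$ and $(Y_1,\dots,Y_n)$ to a permutation in $S_n$, and $d_H(\hat\pi,\pi^\star)=\#\{j:\hat\pi(j)\neq\pi^\star(j)\}$. Then, as $n\to\infty$, $$\inf_{\hat\pi}\mathbb E\left[d_H(\hat\pi,\pi^\star)\right]=\Theta\left((n^2\sigma^d)\wedge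 n\right)$$ uniformly in $\sigma>0$: there are constants $c,C>0$ and $n_0\in\mathbb N$, depending only on $d,\mathcal P,\mathcal Q$, such that for all $n\ge n_0$ and all $\sigma>0$, $$c\left((n^2\sigma^d)\wedge n\right)\ \le\ \inf_{\hat\pi}\mathbb E\left[d_H(\hat\pi,\pi^\star)\right]\ \le\ C\left((n^2\sigma^d)\wedge n\right).$$ The least sum of squares estimator $\hat\pi_{\mathrm{LSS}}\in\arg\min_{\pi\in S_n}\sum_{j=1}^n\|X_{\pi(j)}-Y_j\|_2^2$ (with ties broken in any measurable way) attains this rate: with the same constants, for all $n\ge n_0$ and all $\sigma>0$, $$c\left((n^2\sigma^d)\wedge n\right)\ \le\ \mathbb E\left[d_H(\hat\pi_{\mathrm{LSS}},\pi^\star)\right]\ \le\ C\left((n^2\sigma^d)\wedge n\right).$$ -/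

import Mathlib

open MeasureTheory

noncomputable section

namespace PlantedMatching

/-- Euclidean space of dimension `d`. -/
abbrev Pt (d : ℕ) : Type := EuclideanSpace ℝ (Fin d)

/-- Sequences of `n` points of Euclidean space of dimension `d`. -/
abbrev Pts (n d : ℕ) : Type := Fin n → Pt d

/-- The discrete σ-algebra on the finite group of permutations of `n` letters. -/
instance permMeasurableSpace (n : ℕ) : MeasurableSpace (Equiv.Perm (Fin n)) := ⊤

/-- `μ` has a bounded continuous density with respect to Lebesgue measure. -/
def HasBoundedContinuousDensity {d : ℕ} (μ : Measure (Pt d)) : Prop :=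
  ∃ f : Pt d → ℝ, Continuous f ∧ (∀ x, 0 ≤ f x) ∧ (∃ M : ℝ, ∀ x, f x ≤ M) ∧
    μ = (volume : Measure (Pt d)).withDensity (fun x => ENNReal.ofReal (f x))

/-- `μ` has a first moment, and its mean is the zero vector. -/
def IsZeroMean {d : ℕ} (μ : Measure (Pt d)) : Prop :=
  Integrable (fun z : Pt d => z) μ ∧ ∫ z, z ∂μ = 0

/-- The sub-Gaussian norm `inf {L > 0 : E exp (U ^ 2 / L ^ 2) ≤ 2}` of a real random variable `U`,
with value `⊤` if there is no such `L`. -/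
def subGaussianNorm {Ω : Type*} [MeasurableSpace Ω] (U : Ω → ℝ) (μ : Measure Ω) : ENNReal :=
  ⨅ (L : ℝ) (_ : 0 < L)
    (_ : ∫⁻ ω, ENNReal.ofReal (Real.exp (U ω ^ 2 / L ^ 2)) ∂μ ≤ 2), ENNReal.ofReal L

/-- A random vector with law `μ` is sub-Gaussian: the sub-Gaussian norms of its projections to the
unit vectors are bounded. -/
def IsSubGaussian {d : ℕ} (μ : Measure (Pt d)) : Prop :=
  (⨆ (v : Pt d) (_ : ‖v‖ = 1), subGaussianNorm (fun z : Pt d => inner ℝ z v) μ) < ⊤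

/-- The joint law of `(π⋆, X, Z̃)`: a uniform permutation `π⋆` of `n` letters, `n` i.i.d. points
`X i` with law `P`, and `n` i.i.d. vectors `Z̃ i` with law `Q`, all of them independent. -/
def modelLaw {d : ℕ} (P Q : Measure (Pt d)) (n : ℕ) :
    Measure (Equiv.Perm (Fin n) × Pts n d × Pts n d) :=
  (PMF.uniformOfFintype (Equiv.Perm (Fin n))).toMeasure.prod
    ((Measure.pi fun _ : Fin n => P).prod (Measure.pi fun _ : Fin n => Q))

/-- The perturbed points `Y i = X (π⋆ i) + Z i` with noise `Z i = σ Z̃ i`. -/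
def observed {n d : ℕ} (σ : ℝ) (π : Equiv.Perm (Fin n)) (X Z : Pts n d) : Pts n d :=
  fun i => X (π i) + σ • Z i

/-- An estimator: a (measurable) map from the two observed sequences of points to permutations. -/
structure Estimator (n d : ℕ) where
  /-- The estimated permutation. -/
  toFun : Pts n d → Pts n d → Equiv.Perm (Fin n)
  /-- The estimated permutation is a measurable function of the data. -/
  measurable_toFun : Measurable fun p : Pts n d × Pts n d => toFun p.1 p.2

/-- The expected Hamming distance between the estimated and the planted permutation. -/
def risk {n d : ℕ} (P Q : Measure (Pt d)) (σ : ℝ) (e : Estimator n d) : ℝ :=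
  ∫ ω, (hammingDist (⇑(e.toFun ω.2.1 (observed σ ω.1 ω.2.1 ω.2.2))) (⇑ω.1) : ℝ)
    ∂(modelLaw P Q n)

/-- The infimum of the expected Hamming distance over all estimators. -/
def minimaxRisk {d : ℕ} (P Q : Measure (Pt d)) (n : ℕ) (σ : ℝ) : ℝ :=
  ⨅ e : Estimator n d, risk P Q σ e

/-- The sum of squared Euclidean distances that a permutation incurs. -/
def squareCost {n d : ℕ} (x y : Pts n d) (π : Equiv.Perm (Fin n)) : ℝ :=
  ∑ j, ‖x (π j) - y j‖ ^ 2

/-- `e` is a least sum of squares estimator: it always outputs a minimizer of the sum of squares.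
Ties may be broken in any (measurable) way. -/
def IsLSS {n d : ℕ} (e : Estimator n d) : Prop :=
  ∀ (x y : Pts n d) (π : Equiv.Perm (Fin n)), squareCost x y (e.toFun x y) ≤ squareCost x y π

/-- There is a least sum of squares estimator. -/
theorem exists_isLSS (n d : ℕ) : ∃ e : Estimator n d, IsLSS e := by
  classical
  let E := Fintype.equivFin (Equiv.Perm (Fin n))
  let f : ℕ → Equiv.Perm (Fin n) := fun k =>
    if h : k < Fintype.card (Equiv.Perm (Fin n)) then E.symm ⟨k, h⟩ else 1
  have hf : ∀ π, ∃ k, f k = π := fun π => ⟨E π, by simp [f]⟩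
  let p : ℕ → Pts n d × Pts n d → Prop := fun k q =>
    ∀ π, squareCost q.1 q.2 (f k) ≤ squareCost q.1 q.2 π
  have hp : ∀ q, ∃ k, p k q := by
    intro q
    obtain ⟨π₀, h₀⟩ := Finite.exists_min (fun π => squareCost q.1 q.2 π)
    obtain ⟨k, rfl⟩ := hf π₀
    exact ⟨k, h₀⟩
  have hc : ∀ π : Equiv.Perm (Fin n),
      Measurable fun q : Pts n d × Pts n d => squareCost q.1 q.2 π := by
    intro π
    unfold squareCost
    fun_prop
  have hm : ∀ k, MeasurableSet {q | p k q} := by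
    intro k
    simp only [p, Set.ofPred_forall]
    exact MeasurableSet.iInter fun π => measurableSet_le (hc _) (hc _)
  have hfind : Measurable fun q => Nat.find (hp q) := measurable_find hp hm
  refine ⟨⟨fun x y => f (Nat.find (hp (x, y))), ?_⟩, ?_⟩
  · exact (measurable_from_nat (f := f)).comp hfind
  · intro x y π
    exact Nat.find_spec (hp (x, y)) π

end PlantedMatching

end

open MeasureTheory

noncomputable section

namespace PlantedMatching

/-! Upper bound: let `τ = π⁻¹ * π̂`, with `π̂` a least-squares output. Each error `i` lies on a
nontrivial cycle of `τ`, and undoing that cycle cannot lower the cost. Hence the squared steps `‖X -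
X'‖ ^ 2` along the cycle add up to at most `4σ²` times the sum of the `‖Z̃‖ ^ 2` on it. Dropping the
closing edge leaves a path of `m` edges, and a Chernoff bound replaces this event by a product of
Gaussian kernels in the edges and factors `exp (a‖Z̃‖²)`. As `P` has bounded density, each edge
integrates to at most `Dσ^d`; each noise factor costs `K`. With at most `n^(m+1)` paths, the risk is
at most `∑_{m ≥ 1} nK (nKDσ^d)^m`, a geometric series of order `n²σ^d` when its ratio is at most
`1/2`; otherwise the trivial bound `n` suffices.

Lower bound: replacing `π` by `π * swap a b` and shifting the noises at `a`, `b` by `±(X_{π a} -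
X_{π b})/σ` leaves the data unchanged (`observed_mul_swap`). If the two points are within a multiple
of `σ`, the two noise laws share a component of fixed mass, so every estimator errs at `a` with
probability bounded below, averaged over the two hypotheses. Summing over pairs counts an error once
per close neighbour; a Bonferroni correction for triples removes the overcount. The closeness radius
is chosen of order `min(σ, n^(-1/d))`, which keeps the correction below half of the main term. -/

/-! ### Integrals over i.i.d. families -/

/-- The product of finitely many σ-finite measures is monotone in its factors. -/
theorem pi_measure_mono {ι : Type*} [Fintype ι] {α : ι → Type*} [∀ i, MeasurableSpace (α i)]
    {μ ν : ∀ i, Measure (α i)} [∀ i, SigmaFinite (μ i)] (h : ∀ i, μ i ≤ ν i) :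
    Measure.pi μ ≤ Measure.pi ν := by
  rw [Measure.le_iff]
  intro s hs
  conv_rhs => rw [Measure.pi, toMeasure_apply _ _ hs]
  -- The product outer measure is the largest one bounded by the product on boxes, so only boxes
  -- need comparing.
  have : (Measure.pi μ).toOuterMeasure ≤ OuterMeasure.pi fun i => (ν i).toOuterMeasure := by
    rw [OuterMeasure.le_pi]
    intro t _
    have := Measure.pi_pi μ t
    simp only [Measure.coe_toOuterMeasure]
    rw [this]
    exact Finset.prod_le_prod' fun i _ => h i _
  exact this s

/-- Restricting an i.i.d. family along an injective map of indices gives an i.i.d. family. -/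
theorem measurePreserving_pi_comp_injective {ι κ α : Type*} [Fintype ι] [Fintype κ]
    [MeasurableSpace α] (μ : Measure α) [IsProbabilityMeasure μ] {g : κ → ι}
    (hg : Function.Injective g) :
    MeasurePreserving (fun x : ι → α => fun k => x (g k))
      (Measure.pi fun _ : ι => μ) (Measure.pi fun _ : κ => μ) := by
  refine ⟨by fun_prop, ?_⟩
  have h := (ProbabilityTheory.iIndepFun_pi (μ := fun _ : ι => μ) (X := fun _ x => x)
    (fun _ => aemeasurable_id)).precomp hg
  rw [ProbabilityTheory.iIndepFun_iff_map_fun_eq_pi_map (fun i => (measurable_pi_apply _).aemeasurable)] at h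
  refine h.trans ?_
  congr 1
  ext1 k
  exact (measurePreserving_eval (fun _ : ι => μ) (g k)).map_eq

theorem lintegral_pi_prod_le {α : Type*} [MeasurableSpace α] (μ : Measure α)
    [IsProbabilityMeasure μ] {ψ : α → ENNReal} (hψ : Measurable ψ) (m : ℕ) :
    ∫⁻ z, ∏ j, ψ (z j) ∂(Measure.pi fun _ : Fin m => μ) ≤ (∫⁻ z, ψ z ∂μ) ^ m := by
  have hm : ∀ m, Measurable fun z : Fin m → α => ∏ j, ψ (z j) := fun m =>
    Finset.measurable_prod _ fun j _ => hψ.comp (measurable_pi_apply j)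
  induction m with
  | zero => simp
  | succ m ih =>
    rw [← (measurePreserving_piFinSuccAbove (fun _ : Fin (m + 1) => μ) 0).symm.lintegral_comp
      (hm _)]
    have hm' := (hm (m + 1)).comp
      (MeasurableEquiv.piFinSuccAbove (fun _ : Fin (m + 1) => α) 0).symm.measurable
    rw [lintegral_prod _ (by exact hm'.aemeasurable)]
    simp only [MeasurableEquiv.piFinSuccAbove_symm_apply, Fin.insertNthEquiv_apply,
      Fin.prod_univ_succ, Fin.insertNth_zero', Fin.cons_zero, Fin.cons_succ]
    rw [lintegral_lintegral_mul hψ.aemeasurable (hm m).aemeasurable, pow_succ, mul_comm]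
    gcongr

/-- The expected product of a kernel along a path of i.i.d. points. -/
theorem lintegral_pi_path_le {α : Type*} [MeasurableSpace α] (μ : Measure α)
    [IsProbabilityMeasure μ] {φ : α → α → ENNReal} (hφ : Measurable (Function.uncurry φ))
    {B : ENNReal} (hB : ∀ y, ∫⁻ x, φ x y ∂μ ≤ B) (m : ℕ) :
    ∫⁻ x, ∏ j : Fin m, φ (x j.castSucc) (x j.succ) ∂(Measure.pi fun _ : Fin (m + 1) => μ)
      ≤ B ^ m := by
  have hm : ∀ m, Measurable fun x : Fin (m + 1) → α =>
      ∏ j : Fin m, φ (x j.castSucc) (x j.succ) := fun m =>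
    Finset.measurable_prod _ fun j _ => hφ.comp (by fun_prop : Measurable
      fun x : Fin (m + 1) → α => (x j.castSucc, x j.succ))
  induction m with
  | zero => simp
  | succ m ih =>
    rw [← (measurePreserving_piFinSuccAbove (fun _ : Fin (m + 1 + 1) => μ) 0).symm.lintegral_comp
      (hm _)]
    have hm' := (hm (m + 1)).comp
      (MeasurableEquiv.piFinSuccAbove (fun _ : Fin (m + 1 + 1) => α) 0).symm.measurable
    rw [lintegral_prod_symm _ (by exact hm'.aemeasurable)]
    simp only [MeasurableEquiv.piFinSuccAbove_symm_apply, Fin.insertNthEquiv_apply,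
      Fin.prod_univ_succ (n := m), Fin.insertNth_zero', Fin.castSucc_zero, Fin.cons_zero,
      Fin.cons_succ, Fin.castSucc_succ]
    -- The initial vertex meets only one edge, so integrating it out first costs one factor `B` and
    -- leaves a shorter path.
    calc _ = ∫⁻ y : Fin (m + 1) → α, (∫⁻ x, φ x (y 0) ∂μ) *
            (∏ j : Fin m, φ (y j.castSucc) (y j.succ)) ∂(Measure.pi fun _ => μ) := by
          refine lintegral_congr fun y => ?_
          rw [← lintegral_mul_const]
          exact hφ.comp (measurable_id.prodMk measurable_const)
      _ ≤ ∫⁻ y : Fin (m + 1) → α, B *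
            (∏ j : Fin m, φ (y j.castSucc) (y j.succ)) ∂(Measure.pi fun _ => μ) := by
          gcongr with y
          exact hB _
      _ ≤ B ^ (m + 1) := by
          rw [lintegral_const_mul _ (hm m), pow_succ, mul_comm]
          gcongr

/-! ### The model law and the risk -/

theorem lintegral_modelLaw {d n : ℕ} (P Q : Measure (Pt d)) [IsProbabilityMeasure P]
    [IsProbabilityMeasure Q] {F : Equiv.Perm (Fin n) × Pts n d × Pts n d → ENNReal}
    (hF : Measurable F) :
    ∫⁻ ω, F ω ∂(modelLaw P Q n) = (Fintype.card (Equiv.Perm (Fin n)) : ENNReal)⁻¹ *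
      ∑ π, ∫⁻ X, ∫⁻ Z, F (π, X, Z) ∂(Measure.pi fun _ => Q) ∂(Measure.pi fun _ => P) := by
  rw [modelLaw, lintegral_prod _ hF.aemeasurable, lintegral_fintype, Finset.mul_sum]
  refine Finset.sum_congr rfl fun π _ => ?_
  rw [PMF.toMeasure_apply_singleton _ _ (measurableSet_singleton _),
    PMF.uniformOfFintype_apply, mul_comm, lintegral_prod _ (by fun_prop)]

instance modelLaw_isProbabilityMeasure {d : ℕ} (P Q : Measure (Pt d)) [IsProbabilityMeasure P]
    [IsProbabilityMeasure Q] (n : ℕ) : IsProbabilityMeasure (modelLaw P Q n) := by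
  unfold modelLaw; infer_instance

theorem measurable_estimate {d n : ℕ} (σ : ℝ) (e : Estimator n d) :
    Measurable fun ω : Equiv.Perm (Fin n) × Pts n d × Pts n d =>
      e.toFun ω.2.1 (observed σ ω.1 ω.2.1 ω.2.2) := by
  refine measurable_from_prod_countable_right fun π => ?_
  refine e.measurable_toFun.comp
    (f := fun p : Pts n d × Pts n d => (p.1, observed σ π p.1 p.2)) ?_
  unfold observed
  fun_prop

theorem measurable_loss {d n : ℕ} (σ : ℝ) (e : Estimator n d) :
    Measurable fun ω : Equiv.Perm (Fin n) × Pts n d × Pts n d =>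
      hammingDist (⇑(e.toFun ω.2.1 (observed σ ω.1 ω.2.1 ω.2.2))) (⇑ω.1) :=
  (measurable_of_countable fun p : Equiv.Perm (Fin n) × Equiv.Perm (Fin n) =>
    hammingDist (⇑p.1) (⇑p.2)).comp ((measurable_estimate σ e).prodMk measurable_fst)

theorem ofReal_risk {d n : ℕ} (P Q : Measure (Pt d)) [IsProbabilityMeasure P]
    [IsProbabilityMeasure Q] (σ : ℝ) (e : Estimator n d) :
    ENNReal.ofReal (risk P Q σ e) = ∫⁻ ω,
      (hammingDist (⇑(e.toFun ω.2.1 (observed σ ω.1 ω.2.1 ω.2.2))) (⇑ω.1) : ENNReal)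
        ∂(modelLaw P Q n) := by
  unfold risk
  rw [ofReal_integral_eq_lintegral_ofReal]
  · simp
  -- The loss is bounded by `n`, so the Bochner integral is a genuine expectation and not the
  -- default value `0`.
  · refine Integrable.of_bound (C := n) ?_ (Filter.Eventually.of_forall fun ω => ?_)
    · exact ((measurable_of_countable fun k : ℕ => (k : ℝ)).comp
        (measurable_loss σ e)).aestronglyMeasurable
    · rw [Real.norm_natCast]
      exact Nat.cast_le.2 (hammingDist_le_card_fintype.trans (Fintype.card_fin n).le)
  · exact Filter.Eventually.of_forall fun ω => Nat.cast_nonneg _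

theorem risk_nonneg {d n : ℕ} (P Q : Measure (Pt d)) (σ : ℝ) (e : Estimator n d) :
    0 ≤ risk P Q σ e :=
  integral_nonneg fun _ => Nat.cast_nonneg _

theorem risk_le_card {d n : ℕ} (P Q : Measure (Pt d)) [IsProbabilityMeasure P]
    [IsProbabilityMeasure Q] (σ : ℝ) (e : Estimator n d) : risk P Q σ e ≤ n := by
  have h : ENNReal.ofReal (risk P Q σ e) ≤ ENNReal.ofReal n := by
    rw [ofReal_risk, ENNReal.ofReal_natCast]
    calc _ ≤ ∫⁻ _, (n : ENNReal) ∂(modelLaw P Q n) := by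
          refine lintegral_mono fun ω => Nat.cast_le.2 ?_
          exact hammingDist_le_card_fintype.trans (Fintype.card_fin n).le
      _ = n := by simp
  exact (ENNReal.ofReal_le_ofReal_iff (Nat.cast_nonneg _)).1 h

/-! ### Upper bound: cycles, exponential moments and path weights -/

/-- If a permutation minimizes a sum of pairwise costs, then undoing the cycle through a given
non-fixed point does not reduce the cost along that cycle. -/
theorem exists_cycle_cost_le {n : ℕ} (c : Fin n → Fin n → ℝ) (τ : Equiv.Perm (Fin n))
    (hτ : ∀ ρ : Equiv.Perm (Fin n), ∑ j, c (τ j) j ≤ ∑ j, c (ρ j) j) {i : Fin n} (hi : τ i ≠ i) :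
    ∃ m ∈ Finset.Ico 1 n, ∃ g : Fin (m + 1) ↪ Fin n, g 0 = i ∧
      (∀ j : Fin m, τ (g j.castSucc) = g j.succ) ∧
      ∑ j, c (τ (g j)) (g j) ≤ ∑ j, c (g j) (g j) := by
  classical
  set s := (τ.cycleOf i).support with hs
  have h2 : 2 ≤ s.card := Equiv.Perm.two_le_card_support_cycleOf_iff.2 hi
  obtain ⟨m, hm⟩ : ∃ m, s.card = m + 1 := ⟨s.card - 1, by omega⟩
  have hsn : s.card ≤ n := (Finset.card_le_univ s).trans (Fintype.card_fin n).le
  have hmem : ∀ {j}, j ∈ s ↔ τ.SameCycle i j := by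
    intro j
    rw [hs, Equiv.Perm.mem_support_cycleOf_iff' hi]
  let f : Fin (m + 1) → Fin n := fun j => (τ ^ (j : ℕ)) i
  have himg : Finset.univ.image f = s := by
    ext x
    simp only [Finset.mem_image, Finset.mem_univ, true_and, hmem, f]
    constructor
    · rintro ⟨j, rfl⟩
      exact Equiv.Perm.SameCycle.rfl.pow_right
    · intro hx
      obtain ⟨k, hk, rfl⟩ := hx.exists_pow_eq_of_mem_support (Equiv.Perm.mem_support.2 hi)
      exact ⟨⟨k, by rw [← hm]; exact hk⟩, rfl⟩
  have hinj : Function.Injective f := by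
    have := Finset.injOn_of_card_image_eq (s := Finset.univ) (f := f)
      (by rw [himg, hm, Finset.card_univ, Fintype.card_fin])
    exact fun a b h => this (by simp) (by simp) h
  have hsum : ∀ F : Fin n → ℝ, ∑ j, F (f j) = ∑ x ∈ s, F x := by
    intro F
    rw [← himg, Finset.sum_image (fun a _ b _ h => hinj h)]
  refine ⟨m, Finset.mem_Ico.2 ⟨by omega, by omega⟩, ⟨f, hinj⟩, by simp [f], fun j => ?_, ?_⟩
  · simp [f, pow_succ', Equiv.Perm.mul_apply]
  · simp only [Function.Embedding.coeFn_mk]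
    rw [hsum fun x => c (τ x) x, hsum fun x => c x x]
    -- This competitor fixes the cycle of `i` pointwise and agrees with `τ` elsewhere, so the costs
    -- off the cycle cancel.
    have h := hτ (τ * (τ.cycleOf i)⁻¹)
    rw [← Finset.sum_add_sum_compl s, ← Finset.sum_add_sum_compl s] at h
    have h1 : ∑ x ∈ s, c ((τ * (τ.cycleOf i)⁻¹) x) x = ∑ x ∈ s, c x x := by
      refine Finset.sum_congr rfl fun x hx => ?_
      congr 1
      have hx' : τ.SameCycle i ((τ.cycleOf i)⁻¹ x) := by
        rw [← hmem, hs, ← Equiv.Perm.support_inv, Equiv.Perm.apply_mem_support,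
          Equiv.Perm.support_inv]
        exact hx
      rw [Equiv.Perm.mul_apply, ← hx'.cycleOf_apply, ← Equiv.Perm.mul_apply,
        mul_inv_cancel, Equiv.Perm.one_apply]
    have h2 : ∑ x ∈ sᶜ, c ((τ * (τ.cycleOf i)⁻¹) x) x = ∑ x ∈ sᶜ, c (τ x) x := by
      refine Finset.sum_congr rfl fun x hx => ?_
      have : (τ.cycleOf i)⁻¹ x = x := by
        rw [Equiv.Perm.inv_eq_iff_eq, eq_comm, ← Equiv.Perm.notMem_support]
        exact Finset.mem_compl.1 hx
      rw [Equiv.Perm.mul_apply, this]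
    linarith

/-- A sub-Gaussian random vector has a finite square exponential moment. -/
theorem IsSubGaussian.exists_lintegral_exp_lt_top {d : ℕ} {Q : Measure (Pt d)}
    [IsProbabilityMeasure Q] (hQ : IsSubGaussian Q) (hd : 1 ≤ d) :
    ∃ a : ℝ, 0 < a ∧ ∫⁻ z, ENNReal.ofReal (Real.exp (a * ‖z‖ ^ 2)) ∂Q < ⊤ := by
  have hb : ∀ i : Fin d, ∃ L : ℝ, 0 < L ∧
      ∫⁻ z : Pt d, ENNReal.ofReal (Real.exp (z i ^ 2 / L ^ 2)) ∂Q ≤ 2 := by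
    intro i
    have h1 : subGaussianNorm (fun z : Pt d => inner ℝ z (EuclideanSpace.single i 1)) Q < ⊤ :=
      lt_of_le_of_lt (le_iSup₂ (f := fun (v : Pt d) (_ : ‖v‖ = 1) =>
        subGaussianNorm (fun z : Pt d => inner ℝ z v) Q) (EuclideanSpace.single i 1)
        (by simp)) hQ
    simp only [subGaussianNorm, iInf_lt_iff] at h1
    obtain ⟨L, hL, h, -⟩ := h1
    refine ⟨L, hL, ?_⟩
    simpa [EuclideanSpace.inner_single_right] using h
  choose L hL hLi using hb
  have hd0 : (0 : ℝ) < d := by exact_mod_cast hd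
  let i₀ : Fin d := ⟨0, hd⟩
  have hS : ∀ i, L i ≤ ∑ j, L j := fun i =>
    Finset.single_le_sum (fun j _ => (hL j).le) (Finset.mem_univ i)
  have hS0 : 0 < ∑ j, L j := (hL i₀).trans_le (hS i₀)
  -- Since `‖z‖² ≤ d · max z_i²`, this exponent makes the exponential at most that of the largest
  -- coordinate, hence at most the sum over coordinates.
  refine ⟨1 / (d * (∑ j, L j) ^ 2), by positivity, ?_⟩
  have key : ∀ z : Pt d, ENNReal.ofReal (Real.exp (1 / (d * (∑ j, L j) ^ 2) * ‖z‖ ^ 2)) ≤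
      ∑ i, ENNReal.ofReal (Real.exp (z i ^ 2 / L i ^ 2)) := by
    intro z
    have : Nonempty (Fin d) := ⟨i₀⟩
    obtain ⟨i, hi⟩ := Finite.exists_max fun i => z i ^ 2
    refine le_trans ?_ (Finset.single_le_sum (f := fun i =>
      ENNReal.ofReal (Real.exp (z i ^ 2 / L i ^ 2))) (fun _ _ => zero_le) (Finset.mem_univ i))
    refine ENNReal.ofReal_le_ofReal (Real.exp_le_exp.2 ?_)
    have hz : ‖z‖ ^ 2 ≤ d * z i ^ 2 := by
      rw [EuclideanSpace.norm_sq_eq]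
      calc _ ≤ ∑ _j : Fin d, z i ^ 2 := Finset.sum_le_sum fun j _ => by
            simpa using hi j
        _ = _ := by simp
    calc 1 / (d * (∑ j, L j) ^ 2) * ‖z‖ ^ 2 ≤ 1 / (d * (∑ j, L j) ^ 2) * (d * z i ^ 2) := by
          gcongr
      _ = z i ^ 2 / (∑ j, L j) ^ 2 := by field_simp
      _ ≤ z i ^ 2 / L i ^ 2 := by
          have := hS i
          have := hL i
          gcongr
  refine lt_of_le_of_lt (lintegral_mono key) ?_
  rw [lintegral_finsetSum _ fun i _ => by fun_prop]
  exact ENNReal.sum_lt_top.2 fun i _ => (hLi i).trans_lt ENNReal.ofNat_lt_top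

/-- The cost of one edge: the bounded density is replaced by `M` times Lebesgue measure, and
translation invariance removes `y`. -/
theorem lintegral_gaussian_kernel_le {d : ℕ} {f : Pt d → ℝ} {M : ℝ} (hM : ∀ x, f x ≤ M)
    {b : ℝ} (hb : 0 < b) (y : Pt d) :
    ∫⁻ x, ENNReal.ofReal (Real.exp (-b * ‖x - y‖ ^ 2))
        ∂((volume : Measure (Pt d)).withDensity fun x => ENNReal.ofReal (f x)) ≤
      ENNReal.ofReal M * ENNReal.ofReal ((Real.pi / b) ^ (d / 2 : ℝ)) := by
  have hle : ((volume : Measure (Pt d)).withDensity fun x => ENNReal.ofReal (f x)) ≤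
      ENNReal.ofReal M • volume := by
    rw [← withDensity_const]
    exact withDensity_mono (Filter.Eventually.of_forall fun x => ENNReal.ofReal_le_ofReal (hM x))
  refine (lintegral_mono' hle le_rfl).trans ?_
  rw [lintegral_smul_measure, smul_eq_mul]
  gcongr
  have hG := GaussianFourier.integral_rexp_neg_mul_sq_norm (V := Pt d) hb
  rw [finrank_euclideanSpace_fin] at hG
  rw [lintegral_sub_right_eq_self (fun x : Pt d => ENNReal.ofReal (Real.exp (-b * ‖x‖ ^ 2))) y,
    ← ofReal_integral_eq_lintegral_ofReal, hG]
  -- Integrability follows from the positive value of the Gaussian integral, since a non-integrable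
  -- function has integral `0`.
  · by_contra h
    rw [integral_undef h] at hG
    exact (Real.rpow_pos_of_pos (by positivity) _).ne hG
  · exact Filter.Eventually.of_forall fun x => (Real.exp_pos _).le

/-- The exponential weight of a path of points and noise vectors. -/
def pathWeight {n d : ℕ} (a σ : ℝ) {m : ℕ} (g : Fin (m + 1) → Fin n) (W Z : Pts n d) : ENNReal :=
  (∏ j : Fin m, ENNReal.ofReal
    (Real.exp (-(a / (4 * σ ^ 2)) * ‖W (g j.castSucc) - W (g j.succ)‖ ^ 2))) *
  ∏ j, ENNReal.ofReal (Real.exp (a * ‖Z (g j)‖ ^ 2))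

/-- The Chernoff step: the hypothesis says exactly that the total exponent is nonnegative. -/
theorem one_le_pathWeight {n d m : ℕ} {a σ : ℝ} (ha : 0 < a) (hσ : 0 < σ)
    {g : Fin (m + 1) → Fin n} {W Z : Pts n d}
    (h : ∑ j : Fin m, ‖W (g j.castSucc) - W (g j.succ)‖ ^ 2 ≤ 4 * σ ^ 2 * ∑ j, ‖Z (g j)‖ ^ 2) :
    1 ≤ pathWeight a σ g W Z := by
  unfold pathWeight
  rw [← ENNReal.ofReal_prod_of_nonneg fun _ _ => (Real.exp_pos _).le,
    ← ENNReal.ofReal_prod_of_nonneg fun _ _ => (Real.exp_pos _).le,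
    ← ENNReal.ofReal_mul (Finset.prod_nonneg fun _ _ => (Real.exp_pos _).le),
    ← Real.exp_sum, ← Real.exp_sum, ← Real.exp_add, ← ENNReal.ofReal_one]
  refine ENNReal.ofReal_le_ofReal (Real.one_le_exp ?_)
  rw [← Finset.mul_sum, ← Finset.mul_sum]
  have := mul_le_mul_of_nonneg_left h (show 0 ≤ a / (4 * σ ^ 2) by positivity)
  have h2 : a / (4 * σ ^ 2) * (4 * σ ^ 2 * ∑ j, ‖Z (g j)‖ ^ 2) = a * ∑ j, ‖Z (g j)‖ ^ 2 := by
    field_simp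
  linarith

theorem measurable_pathWeight {n d m : ℕ} (a σ : ℝ) (g : Fin (m + 1) → Fin n)
    (π : Equiv.Perm (Fin n)) :
    Measurable fun p : Pts n d × Pts n d => pathWeight a σ g (fun i => p.1 (π i)) p.2 := by
  unfold pathWeight
  fun_prop

/-- Points and noise are independent and the path visits distinct indices, so the weight factors
into an i.i.d. path and an i.i.d. product. -/
theorem lintegral_pathWeight_le {n d m : ℕ} {P Q : Measure (Pt d)} [IsProbabilityMeasure P]
    [IsProbabilityMeasure Q] {a σ : ℝ} {B : ENNReal}
    (hB : ∀ y, ∫⁻ x, ENNReal.ofReal (Real.exp (-(a / (4 * σ ^ 2)) * ‖x - y‖ ^ 2)) ∂P ≤ B)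
    (g : Fin (m + 1) ↪ Fin n) (π : Equiv.Perm (Fin n)) :
    ∫⁻ X, ∫⁻ Z, pathWeight a σ g (fun i => X (π i)) Z ∂(Measure.pi fun _ : Fin n => Q)
        ∂(Measure.pi fun _ : Fin n => P) ≤
      B ^ m * (∫⁻ z, ENNReal.ofReal (Real.exp (a * ‖z‖ ^ 2)) ∂Q) ^ (m + 1) := by
  unfold pathWeight
  have hZ : Measurable fun Z : Pts n d => ∏ j, ENNReal.ofReal (Real.exp (a * ‖Z (g j)‖ ^ 2)) := by
    fun_prop
  rw [lintegral_lintegral_mul (by fun_prop) hZ.aemeasurable]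
  refine mul_le_mul' ?_ ?_
  · have h := lintegral_pi_path_le P (φ := fun x y =>
      ENNReal.ofReal (Real.exp (-(a / (4 * σ ^ 2)) * ‖x - y‖ ^ 2)))
      (by simp only [Function.uncurry_def]; fun_prop) hB m
    rw [← (measurePreserving_pi_comp_injective P (g := fun j => π (g j))
      (π.injective.comp g.injective)).lintegral_comp (by fun_prop)] at h
    exact h
  · have h := lintegral_pi_prod_le Q (ψ := fun z : Pt d =>
      ENNReal.ofReal (Real.exp (a * ‖z‖ ^ 2))) (by fun_prop) (m + 1)
    rw [← (measurePreserving_pi_comp_injective Q (g := fun j => g j)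
      g.injective).lintegral_comp (by fun_prop)] at h
    exact h

/-- An error of a least sum of squares estimator lies on a path of nearby points. -/
theorem IsLSS.exists_path {n d : ℕ} {e : Estimator n d} (he : IsLSS e) (σ : ℝ)
    (π : Equiv.Perm (Fin n)) (X Z : Pts n d) {i : Fin n}
    (hi : e.toFun X (observed σ π X Z) i ≠ π i) :
    ∃ m ∈ Finset.Ico 1 n, ∃ g : Fin (m + 1) ↪ Fin n, g 0 = i ∧
      ∑ j : Fin m, ‖X (π (g j.castSucc)) - X (π (g j.succ))‖ ^ 2 ≤
        4 * σ ^ 2 * ∑ j, ‖Z (g j)‖ ^ 2 := by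
  set τ : Equiv.Perm (Fin n) := π⁻¹ * e.toFun X (observed σ π X Z) with hτ
  have hτi : τ i ≠ i := by
    rw [hτ, Equiv.Perm.mul_apply, Ne, Equiv.Perm.inv_eq_iff_eq]
    exact hi
  obtain ⟨m, hm, g, hg0, hg, hle⟩ := exists_cycle_cost_le
    (fun i j => ‖X (π i) - observed σ π X Z j‖ ^ 2) τ (fun ρ => by
      have h := he X (observed σ π X Z) (π * ρ)
      simpa [squareCost, hτ] using h) hτi
  refine ⟨m, hm, g, hg0, ?_⟩
  have hpt : ∀ j, ‖X (π (g j)) - X (π (τ (g j)))‖ ^ 2 ≤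
      2 * ‖X (π (τ (g j))) - observed σ π X Z (g j)‖ ^ 2 +
      2 * ‖X (π (g j)) - observed σ π X Z (g j)‖ ^ 2 := by
    intro j
    have h1 := norm_sub_le (X (π (g j)) - observed σ π X Z (g j))
      (X (π (τ (g j))) - observed σ π X Z (g j))
    rw [sub_sub_sub_cancel_right] at h1
    have h2 := pow_le_pow_left₀ (norm_nonneg _) h1 2
    nlinarith [sq_nonneg (‖X (π (g j)) - observed σ π X Z (g j)‖ -
      ‖X (π (τ (g j))) - observed σ π X Z (g j)‖)]
  have hz : ∀ j, ‖X (π (g j)) - observed σ π X Z (g j)‖ ^ 2 = σ ^ 2 * ‖Z (g j)‖ ^ 2 := by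
    intro j
    simp [observed, norm_smul, mul_pow]
  calc ∑ j : Fin m, ‖X (π (g j.castSucc)) - X (π (g j.succ))‖ ^ 2
      = ∑ j : Fin m, ‖X (π (g j.castSucc)) - X (π (τ (g j.castSucc)))‖ ^ 2 := by
        simp only [hg]
    -- The extra term is the edge closing the cycle; without it the edges can be integrated one
    -- vertex at a time.
    _ ≤ ∑ j, ‖X (π (g j)) - X (π (τ (g j)))‖ ^ 2 := by
        rw [Fin.sum_univ_castSucc (n := m)]
        exact le_add_of_nonneg_right (sq_nonneg _)
    _ ≤ ∑ j, (2 * ‖X (π (τ (g j))) - observed σ π X Z (g j)‖ ^ 2 +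
          2 * ‖X (π (g j)) - observed σ π X Z (g j)‖ ^ 2) := Finset.sum_le_sum fun j _ => hpt j
    _ ≤ 4 * ∑ j, ‖X (π (g j)) - observed σ π X Z (g j)‖ ^ 2 := by
        rw [Finset.sum_add_distrib, ← Finset.mul_sum, ← Finset.mul_sum]
        linarith
    _ = _ := by simp only [hz, ← Finset.mul_sum]; ring

/-- A union bound: each error starts a path of weight at least `1`, and each path has only one
starting index. -/
theorem IsLSS.loss_le_sum_pathWeight {n d : ℕ} {e : Estimator n d} (he : IsLSS e) {a σ : ℝ}
    (ha : 0 < a) (hσ : 0 < σ) (π : Equiv.Perm (Fin n)) (X Z : Pts n d) :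
    (hammingDist (⇑(e.toFun X (observed σ π X Z))) (⇑π) : ENNReal) ≤
      ∑ m ∈ Finset.Ico 1 n, ∑ g : Fin (m + 1) ↪ Fin n,
        pathWeight a σ g (fun i => X (π i)) Z := by
  classical
  calc (hammingDist (⇑(e.toFun X (observed σ π X Z))) (⇑π) : ENNReal)
      = ∑ i, if e.toFun X (observed σ π X Z) i ≠ π i then 1 else 0 := by
        rw [hammingDist, Finset.card_filter]
        push_cast
        rfl
    _ ≤ ∑ i, ∑ m ∈ Finset.Ico 1 n, ∑ g : Fin (m + 1) ↪ Fin n,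
          if g 0 = i then pathWeight a σ g (fun i => X (π i)) Z else 0 := by
        refine Finset.sum_le_sum fun i _ => ?_
        split_ifs with hi
        · obtain ⟨m, hm, g, hg, hle⟩ := he.exists_path σ π X Z hi
          refine le_trans ?_ (Finset.single_le_sum (f := fun m => ∑ g : Fin (m + 1) ↪ Fin n,
            if g 0 = i then pathWeight a σ g (fun i => X (π i)) Z else 0)
            (fun _ _ => zero_le) hm)
          refine le_trans ?_ (Finset.single_le_sum (f := fun g : Fin (m + 1) ↪ Fin n =>
            if g 0 = i then pathWeight a σ g (fun i => X (π i)) Z else 0)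
            (fun _ _ => zero_le) (Finset.mem_univ g))
          rw [if_pos hg]
          exact one_le_pathWeight ha hσ hle
        · exact zero_le
    _ = _ := by
        rw [Finset.sum_comm]
        refine Finset.sum_congr rfl fun m _ => ?_
        rw [Finset.sum_comm]
        simp

/-! ### Upper bound: summation over path lengths -/

theorem IsLSS.ofReal_risk_le {n d : ℕ} {e : Estimator n d} (he : IsLSS e) {P Q : Measure (Pt d)}
    [IsProbabilityMeasure P] [IsProbabilityMeasure Q] {a σ : ℝ} (ha : 0 < a) (hσ : 0 < σ)
    {B : ENNReal}
    (hB : ∀ y, ∫⁻ x, ENNReal.ofReal (Real.exp (-(a / (4 * σ ^ 2)) * ‖x - y‖ ^ 2)) ∂P ≤ B) :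
    ENNReal.ofReal (risk P Q σ e) ≤ ∑ m ∈ Finset.Ico 1 n, (n : ENNReal) ^ (m + 1) *
      (B ^ m * (∫⁻ z, ENNReal.ofReal (Real.exp (a * ‖z‖ ^ 2)) ∂Q) ^ (m + 1)) := by
  rw [ofReal_risk, lintegral_modelLaw P Q
    (by exact (measurable_of_countable fun k : ℕ => (k : ENNReal)).comp (measurable_loss σ e))]
  set S := ∑ m ∈ Finset.Ico 1 n, (n : ENNReal) ^ (m + 1) *
      (B ^ m * (∫⁻ z, ENNReal.ofReal (Real.exp (a * ‖z‖ ^ 2)) ∂Q) ^ (m + 1)) with hS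
  have hπ : ∀ π : Equiv.Perm (Fin n), ∫⁻ X, ∫⁻ Z,
      (hammingDist (⇑(e.toFun X (observed σ π X Z))) (⇑π) : ENNReal)
        ∂(Measure.pi fun _ => Q) ∂(Measure.pi fun _ => P) ≤ S := by
    intro π
    calc _ ≤ ∫⁻ X, ∫⁻ Z, ∑ m ∈ Finset.Ico 1 n, ∑ g : Fin (m + 1) ↪ Fin n,
            pathWeight a σ g (fun i => X (π i)) Z
            ∂(Measure.pi fun _ => Q) ∂(Measure.pi fun _ => P) :=
          lintegral_mono fun X => lintegral_mono fun Z =>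
            he.loss_le_sum_pathWeight ha hσ π X Z
      _ = ∑ m ∈ Finset.Ico 1 n, ∑ g : Fin (m + 1) ↪ Fin n, ∫⁻ X, ∫⁻ Z,
            pathWeight a σ g (fun i => X (π i)) Z
            ∂(Measure.pi fun _ => Q) ∂(Measure.pi fun _ => P) := by
          have hm := fun (m : ℕ) (g : Fin (m + 1) ↪ Fin n) =>
            measurable_pathWeight (d := d) a σ g π
          rw [lintegral_lintegral (by
            exact (Finset.measurable_sum _ fun m _ =>
              Finset.measurable_sum _ fun g _ => hm m g).aemeasurable),
            lintegral_finsetSum _ (fun m _ => Finset.measurable_sum _ fun g _ => hm m g)]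
          refine Finset.sum_congr rfl fun m _ => ?_
          rw [lintegral_finsetSum _ (fun g _ => hm m g)]
          refine Finset.sum_congr rfl fun g _ => ?_
          rw [lintegral_lintegral (by exact (hm m g).aemeasurable)]
      _ ≤ S := by
          refine Finset.sum_le_sum fun m _ => ?_
          calc _ ≤ ∑ _g : Fin (m + 1) ↪ Fin n, (B ^ m *
                (∫⁻ z, ENNReal.ofReal (Real.exp (a * ‖z‖ ^ 2)) ∂Q) ^ (m + 1)) :=
                Finset.sum_le_sum fun g _ => lintegral_pathWeight_le hB g π
            _ ≤ _ := by
                rw [Finset.sum_const, nsmul_eq_mul]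
                gcongr
                have : Fintype.card (Fin (m + 1) ↪ Fin n) ≤ n ^ (m + 1) := by
                  rw [Fintype.card_embedding_eq]
                  simpa using Nat.descFactorial_le_pow n (m + 1)
                exact_mod_cast this
  calc _ ≤ (Fintype.card (Equiv.Perm (Fin n)) : ENNReal)⁻¹ *
        ∑ _π : Equiv.Perm (Fin n), S := by
        gcongr with π
        exact hπ π
    _ = S := by
        rw [Finset.sum_const, nsmul_eq_mul, Finset.card_univ, ← mul_assoc,
          ENNReal.inv_mul_cancel (by simp [Fintype.card_ne_zero]) (ENNReal.natCast_ne_top _),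
          one_mul]

/-- The upper bound on the risk of least sum of squares estimators. -/
theorem exists_risk_le {d : ℕ} (hd : 1 ≤ d) {P Q : Measure (Pt d)} [IsProbabilityMeasure P]
    [IsProbabilityMeasure Q] (hP : HasBoundedContinuousDensity P) (hQ : IsSubGaussian Q) :
    ∃ C : ℝ, 0 < C ∧ ∀ (n : ℕ) (σ : ℝ), 0 < σ → ∀ e : Estimator n d, IsLSS e →
      risk P Q σ e ≤ C * min ((n : ℝ) ^ 2 * σ ^ d) (n : ℝ) := by
  obtain ⟨a, ha, hK⟩ := hQ.exists_lintegral_exp_lt_top hd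
  obtain ⟨f, -, -, ⟨M, hM⟩, rfl⟩ := hP
  set K := (∫⁻ z, ENNReal.ofReal (Real.exp (a * ‖z‖ ^ 2)) ∂Q).toReal with hKdef
  have hK' : ∫⁻ z, ENNReal.ofReal (Real.exp (a * ‖z‖ ^ 2)) ∂Q = ENNReal.ofReal K :=
    (ENNReal.ofReal_toReal hK.ne).symm
  have hK0 : 0 ≤ K := ENNReal.toReal_nonneg
  set D := max M 0 * (4 * Real.pi / a) ^ (d / 2 : ℝ) with hD
  have hD0 : 0 ≤ D := by positivity
  -- The summands serve, in turn, the geometric series, the case of ratio above `1/2`, and the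
  -- trivial bound by `n`.
  refine ⟨2 * K ^ 2 * D + 2 * K * D + 1, by positivity, fun n σ hσ e he => ?_⟩
  have hs : 0 < σ ^ d := by positivity
  have hn : (0 : ℝ) ≤ n := Nat.cast_nonneg n
  have hcard := risk_le_card (volume.withDensity fun x => ENNReal.ofReal (f x)) Q σ e
  have hKD : 0 ≤ K * D := by positivity
  have hKKD : 0 ≤ K ^ 2 * D := by positivity
  rw [mul_min_of_nonneg _ _ (by positivity)]
  refine le_min ?_ (by nlinarith)
  have hq0 : 0 ≤ n * K * (D * σ ^ d) := by positivity
  have hns : 0 ≤ (n : ℝ) ^ 2 * σ ^ d := by positivity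
  rcases lt_or_ge (1 / 2) (n * K * (D * σ ^ d)) with hq | hq
  · have : (n : ℝ) ≤ 2 * K * D * (n ^ 2 * σ ^ d) := by nlinarith
    nlinarith
  · have hB : ∀ y, ∫⁻ x, ENNReal.ofReal (Real.exp (-(a / (4 * σ ^ 2)) * ‖x - y‖ ^ 2))
        ∂(volume.withDensity fun x => ENNReal.ofReal (f x)) ≤ ENNReal.ofReal (D * σ ^ d) := by
      intro y
      refine (lintegral_gaussian_kernel_le (fun x => (hM x).trans (le_max_left M 0))
        (by positivity) y).trans ?_
      rw [← ENNReal.ofReal_mul (le_max_right _ _)]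
      refine ENNReal.ofReal_le_ofReal (le_of_eq ?_)
      rw [hD, mul_assoc]
      congr 1
      rw [show Real.pi / (a / (4 * σ ^ 2)) = 4 * Real.pi / a * σ ^ 2 by field_simp,
        Real.mul_rpow (by positivity) (by positivity), ← Real.rpow_natCast, ← Real.rpow_mul hσ.le,
        ← Real.rpow_natCast]
      congr 2
      push_cast
      ring
    have h := he.ofReal_risk_le (Q := Q) ha hσ hB
    have hsum : ∑ m ∈ Finset.Ico 1 n, (n : ENNReal) ^ (m + 1) *
        (ENNReal.ofReal (D * σ ^ d) ^ m *
          (∫⁻ z, ENNReal.ofReal (Real.exp (a * ‖z‖ ^ 2)) ∂Q) ^ (m + 1)) =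
        ENNReal.ofReal (∑ m ∈ Finset.Ico 1 n, n * K * (n * K * (D * σ ^ d)) ^ m) := by
      rw [ENNReal.ofReal_sum_of_nonneg fun m _ => by positivity]
      refine Finset.sum_congr rfl fun m _ => ?_
      rw [hK', ← ENNReal.ofReal_natCast n, ← ENNReal.ofReal_pow hn,
        ← ENNReal.ofReal_pow (by positivity), ← ENNReal.ofReal_pow hK0,
        ← ENNReal.ofReal_mul (by positivity), ← ENNReal.ofReal_mul (by positivity)]
      congr 1
      ring
    rw [hsum, ENNReal.ofReal_le_ofReal_iff
      (Finset.sum_nonneg fun m _ => by positivity), ← Finset.mul_sum] at h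
    have hgeom : ∑ m ∈ Finset.Ico 1 n, (n * K * (D * σ ^ d)) ^ m ≤ 2 * (n * K * (D * σ ^ d)) := by
      set q := n * K * (D * σ ^ d)
      -- The factor `1 - (1/2)^N` makes the induction close: `q ≤ 1/2` gives `q^(N+1) ≤ q (1/2)^N`.
      have h1 : ∀ N : ℕ, (∑ m ∈ Finset.Ico 1 (N + 1), q ^ m) ≤ 2 * q * (1 - (1 / 2) ^ N) := by
        intro N
        induction N with
        | zero => simp
        | succ N ih =>
          rw [Finset.sum_Ico_succ_top (by omega), pow_succ q]
          have : q ^ N ≤ (1 / 2) ^ N := pow_le_pow_left₀ hq0 hq N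
          have := mul_le_mul_of_nonneg_right this hq0
          rw [pow_succ (1 / 2 : ℝ)]
          linarith
      rcases n with _ | N
      · simpa using hq0
      · refine (h1 N).trans ?_
        have : (0 : ℝ) ≤ (1 / 2) ^ N := by positivity
        nlinarith
    calc _ ≤ n * K * (2 * (n * K * (D * σ ^ d))) := h.trans (by gcongr)
      _ = 2 * K ^ 2 * D * (n ^ 2 * σ ^ d) := by ring
      _ ≤ _ := by gcongr; linarith

/-! ### Lower bound: probabilities of close pairs and triples -/

/-- A probability measure with a continuous density dominates a multiple of Lebesgue measure on
some ball. -/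
theorem HasBoundedContinuousDensity.exists_smul_restrict_le {d : ℕ} {μ : Measure (Pt d)}
    [IsProbabilityMeasure μ] (hμ : HasBoundedContinuousDensity μ) :
    ∃ (x₀ : Pt d) (r δ : ℝ), 0 < r ∧ 0 < δ ∧
      ENNReal.ofReal δ • volume.restrict (Metric.ball x₀ (2 * r)) ≤ μ := by
  obtain ⟨f, hf, hf0, -, rfl⟩ := hμ
  obtain ⟨x₀, hx₀⟩ : ∃ x, 0 < f x := by
    by_contra! h
    have h0 : f = fun _ => 0 := funext fun x => le_antisymm (h x) (hf0 x)
    have := measure_univ (μ := volume.withDensity fun x => ENNReal.ofReal (f x))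
    simp [h0] at this
  obtain ⟨ε, hε, hball⟩ := Metric.eventually_nhds_iff_ball.1
    (hf.continuousAt.eventually (lt_mem_nhds (half_lt_self hx₀)))
  -- The density exceeds half its value at `x₀` on the ball of radius `ε = 2r`; stating it with `2r`
  -- leaves room for shifts of size `r`.
  refine ⟨x₀, ε / 2, f x₀ / 2, by positivity, by positivity, ?_⟩
  rw [mul_div_cancel₀ _ two_ne_zero, ← withDensity_const, ← withDensity_indicator
    Metric.isOpen_ball.measurableSet]
  refine withDensity_mono (Filter.Eventually.of_forall fun x => ?_)
  by_cases hx : x ∈ Metric.ball x₀ ε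
  · rw [Set.indicator_of_mem hx]
    exact ENNReal.ofReal_le_ofReal (hball x hx).le
  · rw [Set.indicator_of_notMem hx]
    exact zero_le

theorem HasBoundedContinuousDensity.exists_measure_ball_le {d : ℕ} {μ : Measure (Pt d)}
    (hμ : HasBoundedContinuousDensity μ) :
    ∃ B : ℝ, 0 ≤ B ∧ ∀ (x : Pt d) (ρ : ℝ), 0 < ρ →
      μ (Metric.ball x ρ) ≤ ENNReal.ofReal (B * ρ ^ d) := by
  obtain ⟨f, -, -, ⟨M, hM⟩, rfl⟩ := hμ
  refine ⟨max M 0 * (volume (Metric.ball (0 : Pt d) 1)).toReal, by positivity, fun x ρ hρ => ?_⟩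
  have hle : ((volume : Measure (Pt d)).withDensity fun x => ENNReal.ofReal (f x)) ≤
      ENNReal.ofReal (max M 0) • volume := by
    rw [← withDensity_const]
    exact withDensity_mono (Filter.Eventually.of_forall fun x =>
      ENNReal.ofReal_le_ofReal ((hM x).trans (le_max_left _ _)))
  refine (hle _).trans (le_of_eq ?_)
  rw [Measure.smul_apply, smul_eq_mul, Measure.addHaar_ball_of_pos _ _ hρ,
    finrank_euclideanSpace_fin, ENNReal.ofReal_mul (by positivity),
    ENNReal.ofReal_mul (le_max_right _ _), ENNReal.ofReal_toReal measure_ball_lt_top.ne]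
  ring

/-- The indicator of two points being at distance less than `ρ`. -/
def closeIndicator {d : ℕ} (ρ : ℝ) (x y : Pt d) : ENNReal :=
  (Metric.ball y ρ).indicator (fun _ => 1) x

theorem closeIndicator_comm {d : ℕ} (ρ : ℝ) (x y : Pt d) :
    closeIndicator ρ x y = closeIndicator ρ y x := by
  classical
  simp only [closeIndicator, Set.indicator_apply, Metric.mem_ball, dist_comm]

theorem measurable_closeIndicator (d : ℕ) (ρ : ℝ) :
    Measurable (Function.uncurry (closeIndicator (d := d) ρ)) := by
  have : Function.uncurry (closeIndicator (d := d) ρ) =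
      {p : Pt d × Pt d | dist p.1 p.2 < ρ}.indicator fun _ => 1 := by
    classical
    ext ⟨x, y⟩
    simp [closeIndicator, Set.indicator_apply]
  rw [this]
  exact measurable_const.indicator (measurableSet_lt (by fun_prop) measurable_const)

theorem measurable_closeIndicator_comp {α : Type*} [MeasurableSpace α] {d : ℕ} (ρ : ℝ)
    {f g : α → Pt d} (hf : Measurable f) (hg : Measurable g) :
    Measurable fun x => closeIndicator ρ (f x) (g x) := by
  have h := (measurable_closeIndicator d ρ).comp (hf.prodMk hg)
  simpa only [Function.comp_def, Function.uncurry_apply_pair] using h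

theorem lintegral_closeIndicator {d : ℕ} (μ : Measure (Pt d)) (ρ : ℝ) (y : Pt d) :
    ∫⁻ x, closeIndicator ρ x y ∂μ = μ (Metric.ball y ρ) := by
  simp only [closeIndicator]
  rw [lintegral_indicator_const Metric.isOpen_ball.measurableSet, one_mul]

/-- The probability that two of the points are close. -/
theorem HasBoundedContinuousDensity.exists_le_lintegral_closeIndicator {d : ℕ}
    {P : Measure (Pt d)} [IsProbabilityMeasure P] (hP : HasBoundedContinuousDensity P) :
    ∃ r c : ℝ, 0 < r ∧ 0 < c ∧ ∀ (n : ℕ) (i j : Fin n), i ≠ j → ∀ ρ : ℝ, 0 < ρ → ρ ≤ r →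
      ENNReal.ofReal (c * ρ ^ d) ≤
        ∫⁻ X, closeIndicator ρ (X i) (X j) ∂(Measure.pi fun _ : Fin n => P) := by
  obtain ⟨x₀, r, δ, hr, hδ, hle⟩ := hP.exists_smul_restrict_le
  set v := (volume (Metric.ball (0 : Pt d) 1)).toReal with hv
  have hv0 : 0 < v := ENNReal.toReal_pos (Metric.measure_ball_pos _ _ one_pos).ne'
    measure_ball_lt_top.ne
  have hvol : ∀ (x : Pt d) (ρ : ℝ), 0 < ρ →
      volume (Metric.ball x ρ) = ENNReal.ofReal (ρ ^ d * v) := by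
    intro x ρ hρ
    rw [Measure.addHaar_ball_of_pos _ _ hρ, finrank_euclideanSpace_fin,
      ENNReal.ofReal_mul (by positivity), hv, ENNReal.ofReal_toReal measure_ball_lt_top.ne]
  -- One factor bounds the mass of the ball of radius `r` around `x₀`; the other, times `ρ^d`, that
  -- of a `ρ`-ball centred in it.
  refine ⟨r, (δ * (r ^ d * v)) * (δ * v), hr, by positivity, fun n i j hij ρ hρ hρr => ?_⟩
  have hg : Function.Injective ![i, j] := by
    simp [Function.Injective, Fin.forall_fin_two, hij, hij.symm]
  have h1 := (measurePreserving_pi_comp_injective P hg).lintegral_comp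
    (f := fun x => closeIndicator ρ (x 0) (x 1))
    (measurable_closeIndicator_comp ρ (measurable_pi_apply 0) (measurable_pi_apply 1))
  have h2 := (measurePreserving_finTwoArrow P).lintegral_comp (measurable_closeIndicator d ρ)
  simp only [Matrix.cons_val_zero, Matrix.cons_val_one] at h1
  rw [h1]
  simp only [MeasurableEquiv.finTwoArrow_apply, Function.uncurry_apply_pair] at h2
  rw [h2, lintegral_prod_symm _ (measurable_closeIndicator d ρ).aemeasurable]
  simp only [Function.uncurry_apply_pair, lintegral_closeIndicator]
  have hlow : ∀ y ∈ Metric.ball x₀ r, ENNReal.ofReal (δ * v * ρ ^ d) ≤ P (Metric.ball y ρ) := by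
    intro y hy
    refine le_trans (le_of_eq ?_) (hle (Metric.ball y ρ))
    rw [Measure.smul_apply, smul_eq_mul, Measure.restrict_apply Metric.isOpen_ball.measurableSet,
      Set.inter_eq_left.2, hvol _ _ hρ, ← ENNReal.ofReal_mul hδ.le]
    · congr 1
      ring
    · refine Metric.ball_subset_ball' ?_
      have := Metric.mem_ball.1 hy
      linarith
  calc ENNReal.ofReal (δ * (r ^ d * v) * (δ * v) * ρ ^ d)
      = ENNReal.ofReal (δ * v * ρ ^ d) *
          (ENNReal.ofReal δ • volume.restrict (Metric.ball x₀ (2 * r))) (Metric.ball x₀ r) := by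
        rw [Measure.smul_apply, smul_eq_mul,
          Measure.restrict_apply Metric.isOpen_ball.measurableSet, Set.inter_eq_left.2
          (Metric.ball_subset_ball (by linarith)), hvol _ _ hr, ← ENNReal.ofReal_mul hδ.le,
          ← ENNReal.ofReal_mul (by positivity)]
        congr 1
        ring
    _ ≤ ENNReal.ofReal (δ * v * ρ ^ d) * P (Metric.ball x₀ r) := by
        gcongr
    _ = ∫⁻ _ in Metric.ball x₀ r, ENNReal.ofReal (δ * v * ρ ^ d) ∂P := by
        rw [setLIntegral_const]
    _ ≤ ∫⁻ y in Metric.ball x₀ r, P (Metric.ball y ρ) ∂P :=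
        setLIntegral_mono' Metric.isOpen_ball.measurableSet hlow
    _ ≤ _ := setLIntegral_le_lintegral _ _

/-- The probability that two of the points are both close to a third one. -/
theorem lintegral_closeIndicator_mul_le {d n : ℕ} {P : Measure (Pt d)} [IsProbabilityMeasure P]
    {ρ : ℝ} {B : ENNReal} (hB : ∀ x : Pt d, P (Metric.ball x ρ) ≤ B) {i j k : Fin n}
    (hij : i ≠ j) (hik : i ≠ k) (hjk : j ≠ k) :
    ∫⁻ X, closeIndicator ρ (X i) (X j) * closeIndicator ρ (X i) (X k)
      ∂(Measure.pi fun _ : Fin n => P) ≤ B ^ 2 := by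
  -- The two closeness conditions form a path with middle vertex `i`.
  have hg : Function.Injective ![j, i, k] := by
    intro a b h
    fin_cases a <;> fin_cases b <;> simp_all
  have h := lintegral_pi_path_le P (measurable_closeIndicator d ρ)
    (fun y => (lintegral_closeIndicator P ρ y).trans_le (hB y)) 2
  rw [← (measurePreserving_pi_comp_injective P hg).lintegral_comp (by
    exact Finset.measurable_prod _ fun _ _ => measurable_closeIndicator_comp ρ
      (measurable_pi_apply _) (measurable_pi_apply _))] at h
  simpa [Fin.prod_univ_two, closeIndicator_comm ρ _ _] using h

/-! ### Lower bound: indistinguishable hypotheses -/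

/-- Two hypotheses that differ by opposite small shifts of two noise vectors cannot be told apart
reliably. -/
theorem HasBoundedContinuousDensity.exists_le_lintegral_add_shift {d : ℕ} {Q : Measure (Pt d)}
    [IsProbabilityMeasure Q] (hQ : HasBoundedContinuousDensity Q) :
    ∃ r κ : ℝ, 0 < r ∧ 0 < κ ∧ ∀ (n : ℕ) (a b : Fin n), a ≠ b → ∀ u : Pt d, ‖u‖ ≤ r →
      ∀ H₀ H₁ : Pts n d → ENNReal, Measurable H₀ → Measurable H₁ →
      (∀ Z, 1 ≤ H₀ Z + H₁ (Z + (Pi.single a u - Pi.single b u))) →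
      ENNReal.ofReal κ ≤ ∫⁻ Z, H₀ Z ∂(Measure.pi fun _ => Q) +
        ∫⁻ Z, H₁ Z ∂(Measure.pi fun _ => Q) := by
  obtain ⟨z₀, r, δ, hr, hδ, hle⟩ := hQ.exists_smul_restrict_le
  set ν : Measure (Pt d) := ENNReal.ofReal δ • volume.restrict (Metric.ball z₀ r) with hν
  have hνlt : ν Set.univ < ⊤ := by
    simp only [hν, Measure.smul_apply, Measure.restrict_apply_univ, smul_eq_mul]
    exact ENNReal.mul_lt_top ENNReal.ofReal_lt_top measure_ball_lt_top
  have hνpos : ν Set.univ ≠ 0 := by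
    simp only [hν, Measure.smul_apply, Measure.restrict_apply_univ, smul_eq_mul]
    exact mul_ne_zero (by simpa using hδ) (Metric.measure_ball_pos _ _ hr).ne'
  have : IsFiniteMeasure ν := ⟨hνlt⟩
  have hshift : ∀ w : Pt d, ‖w‖ ≤ r → ν.map (· + w) ≤ Q := by
    intro w hw
    refine le_trans ?_ hle
    rw [Measure.le_iff]
    intro s hs
    rw [Measure.map_apply (measurable_add_const w) hs, hν, Measure.smul_apply, Measure.smul_apply,
      Measure.restrict_apply (measurable_add_const w hs), Measure.restrict_apply hs]
    refine mul_le_mul_right ?_ _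
    rw [← measure_preimage_add_right volume w (s ∩ _)]
    refine measure_mono fun x hx => ⟨hx.1, ?_⟩
    have h1 := Metric.mem_ball.1 hx.2
    have h2 := dist_triangle (x + w) x z₀
    rw [dist_self_add_left] at h2
    exact Metric.mem_ball.2 (by linarith)
  have hνQ : ν ≤ Q := by simpa using hshift 0 (by simpa using hr.le)
  refine ⟨r, ((ν Set.univ) ^ 2).toReal, hr, ENNReal.toReal_pos (pow_ne_zero _ hνpos)
    (ENNReal.pow_ne_top hνlt.ne), fun n a b hab u hu H₀ H₁ hH₀ hH₁ hH => ?_⟩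
  rw [ENNReal.ofReal_toReal (ENNReal.pow_ne_top hνlt.ne)]
  classical
  -- Only the two shifted coordinates are cut down to `ν`, so the common component has mass
  -- `ν(univ)²`, independent of `n`.
  let μ : Fin n → Measure (Pt d) := fun j => if j ∈ ({a, b} : Finset (Fin n)) then ν else Q
  have : ∀ j, IsFiniteMeasure (μ j) := fun j => by
    simp only [μ]; split_ifs <;> infer_instance
  set v : Pts n d := Pi.single a u - Pi.single b u with hv
  have hle₀ : Measure.pi μ ≤ Measure.pi fun _ => Q := by
    refine pi_measure_mono fun j => ?_
    simp only [μ]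
    split_ifs
    · exact hνQ
    · exact le_rfl
  have hle₁ : (Measure.pi μ).map (· + v) ≤ Measure.pi fun _ => Q := by
    have h := Measure.pi_map_pi (μ := μ) (f := fun j x => x + v j)
      (fun j => (measurable_add_const _).aemeasurable)
    refine (show (Measure.pi μ).map (· + v) = _ from h).trans_le ?_
    refine pi_measure_mono fun j => ?_
    by_cases hja : j = a
    · subst hja
      simpa [μ, hv, hab] using hshift u hu
    by_cases hjb : j = b
    · subst hjb
      simpa [μ, hv, hja] using hshift (-u) (by simpa using hu)
    · simp [μ, hv, hja, hjb]
  calc ν Set.univ ^ 2 = (Measure.pi μ) Set.univ := by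
        rw [Measure.pi_univ]
        have : ∀ j, μ j Set.univ = if j ∈ ({a, b} : Finset (Fin n)) then ν Set.univ else 1 := by
          intro j
          simp only [μ]
          split_ifs <;> simp
        simp only [this]
        rw [Finset.prod_ite_mem, Finset.univ_inter, Finset.prod_const, Finset.card_pair hab]
    _ = ∫⁻ _, 1 ∂(Measure.pi μ) := by rw [lintegral_one]
    _ ≤ ∫⁻ Z, (H₀ Z + H₁ (Z + v)) ∂(Measure.pi μ) := lintegral_mono hH
    _ = ∫⁻ Z, H₀ Z ∂(Measure.pi μ) + ∫⁻ Z, H₁ Z ∂((Measure.pi μ).map (· + v)) := by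
        rw [lintegral_add_left hH₀, lintegral_map hH₁ (measurable_add_const v)]
    _ ≤ _ := add_le_add (lintegral_mono' hle₀ le_rfl) (lintegral_mono' hle₁ le_rfl)

/-- The indicator of an error of the estimator `e` at `a`. -/
def errorIndicator {n d : ℕ} (σ : ℝ) (e : Estimator n d) (a : Fin n) (π : Equiv.Perm (Fin n))
    (X Z : Pts n d) : ENNReal :=
  if e.toFun X (observed σ π X Z) a = π a then 0 else 1

theorem measurable_errorIndicator {n d : ℕ} (σ : ℝ) (e : Estimator n d) (a : Fin n)
    (π : Equiv.Perm (Fin n)) :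
    Measurable fun p : Pts n d × Pts n d => errorIndicator σ e a π p.1 p.2 :=
  (measurable_of_countable fun ρ : Equiv.Perm (Fin n) => if ρ a = π a then (0 : ENNReal) else 1).comp
    ((measurable_estimate σ e).comp (measurable_const.prodMk measurable_id))

theorem loss_eq_sum_errorIndicator {n d : ℕ} (σ : ℝ) (e : Estimator n d)
    (π : Equiv.Perm (Fin n)) (X Z : Pts n d) :
    (hammingDist (⇑(e.toFun X (observed σ π X Z))) (⇑π) : ENNReal) =
      ∑ a, errorIndicator σ e a π X Z := by
  simp only [hammingDist, Finset.card_filter, errorIndicator, Nat.cast_sum, Nat.cast_ite,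
    Nat.cast_one, Nat.cast_zero, ite_not]

/-- The estimator sees identical data under `π` and `π * swap a b` once the noise absorbs the
displacement. -/
theorem observed_mul_swap {n d : ℕ} {σ : ℝ} (hσ : σ ≠ 0) (π : Equiv.Perm (Fin n)) {a b : Fin n}
    (hab : a ≠ b) (X Z : Pts n d) :
    observed σ (π * Equiv.swap a b) X (Z + (Pi.single a (σ⁻¹ • (X (π a) - X (π b))) -
      Pi.single b (σ⁻¹ • (X (π a) - X (π b))))) = observed σ π X Z := by
  ext1 i
  simp only [observed, Equiv.Perm.mul_apply, Pi.add_apply, Pi.sub_apply, smul_add, smul_sub]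
  by_cases hia : i = a
  · subst hia
    simp [hab, smul_inv_smul₀ hσ, ← smul_sub]
    abel
  by_cases hib : i = b
  · subst hib
    simp [hia, smul_inv_smul₀ hσ, ← smul_sub]
    abel
  · simp [hia, hib, Equiv.swap_apply_of_ne_of_ne hia hib]

/-- Averaged over the planted permutation, an estimator errs with positive probability at an
index whose point is close to that of another given index. -/
theorem card_mul_le_sum_lintegral_closeIndicator_mul {n d : ℕ} {P Q : Measure (Pt d)}
    [IsProbabilityMeasure P] [IsProbabilityMeasure Q] {r κ p : ℝ}
    (hκ : ∀ (n : ℕ) (a b : Fin n), a ≠ b → ∀ u : Pt d, ‖u‖ ≤ r →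
      ∀ H₀ H₁ : Pts n d → ENNReal, Measurable H₀ → Measurable H₁ →
      (∀ Z, 1 ≤ H₀ Z + H₁ (Z + (Pi.single a u - Pi.single b u))) →
      ENNReal.ofReal κ ≤ ∫⁻ Z, H₀ Z ∂(Measure.pi fun _ => Q) +
        ∫⁻ Z, H₁ Z ∂(Measure.pi fun _ => Q)) (hκ0 : 0 < κ)
    {σ ρ : ℝ} (hσ : 0 < σ) (hρ : ρ ≤ r * σ)
    (hp : ∀ i j : Fin n, i ≠ j → ENNReal.ofReal p ≤
      ∫⁻ X, closeIndicator ρ (X i) (X j) ∂(Measure.pi fun _ : Fin n => P))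
    (e : Estimator n d) {a b : Fin n} (hab : a ≠ b) :
    (Fintype.card (Equiv.Perm (Fin n)) : ENNReal) * ENNReal.ofReal (κ * p / 2) ≤
      ∑ π : Equiv.Perm (Fin n), ∫⁻ X, ∫⁻ Z,
        closeIndicator ρ (X (π a)) (X (π b)) * errorIndicator σ e a π X Z
        ∂(Measure.pi fun _ => Q) ∂(Measure.pi fun _ => P) := by
  set A : Equiv.Perm (Fin n) → ENNReal := fun π => ∫⁻ X, ∫⁻ Z,
        closeIndicator ρ (X (π a)) (X (π b)) * errorIndicator σ e a π X Z
        ∂(Measure.pi fun _ => Q) ∂(Measure.pi fun _ => P) with hA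
  have hme := fun π => measurable_errorIndicator (d := d) σ e a π
  have hmeX : ∀ π X, Measurable fun Z => errorIndicator σ e a π X Z := fun π X =>
    (hme π).comp (measurable_const.prodMk measurable_id)
  have hmc : ∀ i j : Fin n, Measurable fun X : Pts n d => closeIndicator ρ (X i) (X j) :=
    fun i j => measurable_closeIndicator_comp ρ (measurable_pi_apply i) (measurable_pi_apply j)
  have hA' : ∀ π, A π = ∫⁻ X, closeIndicator ρ (X (π a)) (X (π b)) *
      ∫⁻ Z, errorIndicator σ e a π X Z ∂(Measure.pi fun _ => Q) ∂(Measure.pi fun _ => P) := by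
    intro π
    refine lintegral_congr fun X => ?_
    rw [lintegral_const_mul _ (hmeX π X)]
  -- The same output cannot be correct at `a` under both hypotheses, because `π a ≠ π b`. Summing
  -- over all `π` counts each pair twice, whence the final factor `1/2`.
  have hpair : ∀ π, ENNReal.ofReal (κ * p) ≤ A π + A (π * Equiv.swap a b) := by
    intro π
    have hm : Measurable fun X => closeIndicator ρ (X (π a)) (X (π b)) *
        ∫⁻ Z, errorIndicator σ e a π X Z ∂(Measure.pi fun _ => Q) :=
      (hmc _ _).mul (hme π).lintegral_prod_right'
    rw [hA', hA', ← lintegral_add_left hm]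
    calc ENNReal.ofReal (κ * p) ≤ ENNReal.ofReal κ *
          ∫⁻ X, closeIndicator ρ (X (π a)) (X (π b)) ∂(Measure.pi fun _ => P) := by
          rw [ENNReal.ofReal_mul hκ0.le]
          gcongr
          exact hp _ _ (π.injective.ne hab)
      _ = ∫⁻ X, closeIndicator ρ (X (π a)) (X (π b)) * ENNReal.ofReal κ
            ∂(Measure.pi fun _ => P) := by
          rw [lintegral_mul_const _ (hmc _ _), mul_comm]
      _ ≤ _ := by
          refine lintegral_mono fun X => ?_
          have hc : closeIndicator ρ (X ((π * Equiv.swap a b) a))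
              (X ((π * Equiv.swap a b) b)) = closeIndicator ρ (X (π a)) (X (π b)) := by
            rw [closeIndicator_comm]
            simp
          simp only [hc]
          rw [← mul_add]
          by_cases hX : X (π a) ∈ Metric.ball (X (π b)) ρ
          · gcongr
            refine hκ n a b hab (σ⁻¹ • (X (π a) - X (π b))) ?_ _ _ (hmeX _ _) (hmeX _ _)
              fun Z => ?_
            · rw [norm_smul, norm_inv, Real.norm_of_nonneg hσ.le, inv_mul_le_iff₀ hσ,
                ← dist_eq_norm, mul_comm]
              exact (Metric.mem_ball.1 hX).le.trans hρ
            · simp only [errorIndicator]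
              rw [observed_mul_swap hσ.ne' π hab]
              by_cases h : e.toFun X (observed σ π X Z) a = π a
              · rw [if_neg (show ¬ _ = (π * Equiv.swap a b) a from ?_)]
                · exact le_add_self
                · rw [h, Equiv.Perm.mul_apply, Equiv.swap_apply_left]
                  exact π.injective.ne hab
              · rw [if_neg h]
                exact le_self_add
          · have : closeIndicator ρ (X (π a)) (X (π b)) = 0 := Set.indicator_of_notMem hX _
            simp [this]
  have hsum : ∑ π, A (π * Equiv.swap a b) = ∑ π, A π :=
    Equiv.sum_comp (Equiv.mulRight (Equiv.swap a b)) A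
  have h2 : (Fintype.card (Equiv.Perm (Fin n)) : ENNReal) * ENNReal.ofReal (κ * p) ≤
      2 * ∑ π, A π := by
    calc _ = ∑ _π : Equiv.Perm (Fin n), ENNReal.ofReal (κ * p) := by
          rw [Finset.sum_const, nsmul_eq_mul, Finset.card_univ]
      _ ≤ ∑ π, (A π + A (π * Equiv.swap a b)) := Finset.sum_le_sum fun π _ => hpair π
      _ = _ := by rw [Finset.sum_add_distrib, hsum, two_mul]
  rw [ENNReal.ofReal_div_of_pos two_pos, ← mul_div_assoc, ENNReal.ofReal_ofNat]
  exact ENNReal.div_le_of_le_mul' h2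

/-! ### Lower bound: from pairs to the risk -/

/-- A Bonferroni inequality for the number of neighbours of a point at which an error occurs. -/
theorem sum_closeIndicator_mul_le {n d : ℕ} (ρ : ℝ) (W : Pts n d) (a : Fin n) {t : ENNReal}
    (ht : t = 0 ∨ t = 1) :
    ∑ b ∈ Finset.univ.erase a, closeIndicator ρ (W a) (W b) * t ≤
      t + ∑ b ∈ Finset.univ.erase a, ∑ b' ∈ (Finset.univ.erase a).erase b,
        closeIndicator ρ (W a) (W b) * closeIndicator ρ (W a) (W b') := by
  classical
  rcases ht with rfl | rfl
  · simp
  -- One neighbour `b` is charged to `t = 1`, and every other neighbour `b'` to the pair `(b, b')`.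
  by_cases h : ∃ b ∈ Finset.univ.erase a, W a ∈ Metric.ball (W b) ρ
  · obtain ⟨b, hb, hW⟩ := h
    have h1 : closeIndicator ρ (W a) (W b) = 1 := Set.indicator_of_mem hW _
    rw [← Finset.add_sum_erase _ _ hb, h1, one_mul]
    gcongr
    refine le_trans (le_of_eq ?_) (Finset.single_le_sum (f := fun b =>
      ∑ b' ∈ (Finset.univ.erase a).erase b, closeIndicator ρ (W a) (W b) *
        closeIndicator ρ (W a) (W b')) (fun _ _ => zero_le) hb)
    refine Finset.sum_congr rfl fun b' _ => ?_
    rw [h1, one_mul, mul_one]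
  · push Not at h
    rw [Finset.sum_eq_zero fun b hb => ?_]
    · exact zero_le
    · rw [closeIndicator, Set.indicator_of_notMem (h b hb), zero_mul]

/-- Summing the pair bound over `(a, b)` overcounts an error at an index with several close
neighbours; at most `n³` triples, each costing `B²`, pay for this. -/
theorem le_ofReal_risk_add {n d : ℕ} {P Q : Measure (Pt d)}
    [IsProbabilityMeasure P] [IsProbabilityMeasure Q] {σ ρ : ℝ} {q B : ENNReal}
    (hB : ∀ x : Pt d, P (Metric.ball x ρ) ≤ B) (e : Estimator n d)
    (hq : ∀ a b : Fin n, a ≠ b → (Fintype.card (Equiv.Perm (Fin n)) : ENNReal) * q ≤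
      ∑ π : Equiv.Perm (Fin n), ∫⁻ X, ∫⁻ Z,
        closeIndicator ρ (X (π a)) (X (π b)) * errorIndicator σ e a π X Z
        ∂(Measure.pi fun _ => Q) ∂(Measure.pi fun _ => P)) :
    (n : ENNReal) * ((n - 1 : ℕ) * q) ≤
      ENNReal.ofReal (risk P Q σ e) + n * (n * (n * B ^ 2)) := by
  rw [ofReal_risk, lintegral_modelLaw P Q
    (by exact (measurable_of_countable fun k : ℕ => (k : ENNReal)).comp (measurable_loss σ e))]
  simp only [loss_eq_sum_errorIndicator]
  set N : ENNReal := (Fintype.card (Equiv.Perm (Fin n)) : ENNReal) with hN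
  have hN0 : N ≠ 0 := by simp [hN, Fintype.card_ne_zero]
  have hNt : N ≠ ⊤ := ENNReal.natCast_ne_top _
  have hme := fun a π => measurable_errorIndicator (d := d) σ e a π
  have hmc : ∀ i j : Fin n, Measurable fun p : Pts n d × Pts n d =>
      closeIndicator ρ (p.1 i) (p.1 j) :=
    fun i j => measurable_closeIndicator_comp ρ (by fun_prop) (by fun_prop)
  have hmm : ∀ i j k : Fin n, Measurable fun p : Pts n d × Pts n d =>
      closeIndicator ρ (p.1 i) (p.1 j) * closeIndicator ρ (p.1 i) (p.1 k) :=
    fun i j k => (hmc i j).mul (hmc i k)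
  have hmce : ∀ (π : Equiv.Perm (Fin n)) (a b : Fin n), Measurable fun p : Pts n d × Pts n d =>
      closeIndicator ρ (p.1 (π a)) (p.1 (π b)) * errorIndicator σ e a π p.1 p.2 :=
    fun π a b => (hmc (π a) (π b)).mul (hme a π)
  have hπ : ∀ π : Equiv.Perm (Fin n),
      ∑ a, ∑ b ∈ Finset.univ.erase a, ∫⁻ X, ∫⁻ Z,
        closeIndicator ρ (X (π a)) (X (π b)) * errorIndicator σ e a π X Z
        ∂(Measure.pi fun _ => Q) ∂(Measure.pi fun _ => P) ≤
      (∫⁻ X, ∫⁻ Z, ∑ a, errorIndicator σ e a π X Z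
        ∂(Measure.pi fun _ => Q) ∂(Measure.pi fun _ => P)) + n * (n * (n * B ^ 2)) := by
    intro π
    set μ := (Measure.pi fun _ : Fin n => P).prod (Measure.pi fun _ : Fin n => Q) with hμ
    have hb : ∀ a, ∑ b ∈ Finset.univ.erase a, ∫⁻ p,
        closeIndicator ρ (p.1 (π a)) (p.1 (π b)) * errorIndicator σ e a π p.1 p.2 ∂μ ≤
        ∫⁻ p, errorIndicator σ e a π p.1 p.2 ∂μ + n * (n * B ^ 2) := by
      intro a
      rw [← lintegral_finsetSum _ fun b _ => hmce π a b]
      calc _ ≤ ∫⁻ p, (errorIndicator σ e a π p.1 p.2 + ∑ b ∈ Finset.univ.erase a,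
              ∑ b' ∈ (Finset.univ.erase a).erase b,
              closeIndicator ρ (p.1 (π a)) (p.1 (π b)) *
                closeIndicator ρ (p.1 (π a)) (p.1 (π b'))) ∂μ := by
            refine lintegral_mono fun p => ?_
            refine sum_closeIndicator_mul_le ρ (fun i => p.1 (π i)) a ?_
            unfold errorIndicator
            split_ifs <;> simp
        _ = ∫⁻ p, errorIndicator σ e a π p.1 p.2 ∂μ + ∑ b ∈ Finset.univ.erase a,
              ∑ b' ∈ (Finset.univ.erase a).erase b,
              ∫⁻ p, closeIndicator ρ (p.1 (π a)) (p.1 (π b)) *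
                closeIndicator ρ (p.1 (π a)) (p.1 (π b')) ∂μ := by
            rw [lintegral_add_left (hme a π), lintegral_finsetSum _ fun b _ =>
              Finset.measurable_sum _ fun b' _ => hmm (π a) (π b) (π b')]
            congr 1
            refine Finset.sum_congr rfl fun b _ => ?_
            rw [lintegral_finsetSum _ fun b' _ => hmm (π a) (π b) (π b')]
        _ ≤ ∫⁻ p, errorIndicator σ e a π p.1 p.2 ∂μ + ∑ b ∈ Finset.univ.erase a,
              ∑ b' ∈ (Finset.univ.erase a).erase b, B ^ 2 := by
            gcongr with b hb b' hb'
            have hba := Finset.ne_of_mem_erase hb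
            have hbb := Finset.ne_of_mem_erase hb'
            have hba' := Finset.ne_of_mem_erase (Finset.mem_of_mem_erase hb')
            rw [hμ, lintegral_prod _ (hmm (π a) (π b) (π b')).aemeasurable]
            simp only [lintegral_const, measure_univ, mul_one]
            exact lintegral_closeIndicator_mul_le hB (π.injective.ne hba.symm)
              (π.injective.ne hba'.symm) (π.injective.ne hbb.symm)
        _ ≤ ∫⁻ p, errorIndicator σ e a π p.1 p.2 ∂μ + ∑ _b : Fin n, ∑ _b' : Fin n, B ^ 2 := by
            gcongr
            · exact (Finset.sum_le_sum fun b _ => Finset.sum_le_sum_of_subset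
                (Finset.subset_univ _)).trans
                  (Finset.sum_le_sum_of_subset (Finset.subset_univ _))
        _ = _ := by simp
    have h1 : ∀ F : Pts n d × Pts n d → ENNReal, Measurable F →
        ∫⁻ X, ∫⁻ Z, F (X, Z) ∂(Measure.pi fun _ => Q) ∂(Measure.pi fun _ => P) =
          ∫⁻ p, F p ∂μ := fun F hF => (lintegral_prod _ hF.aemeasurable).symm
    calc _ = ∑ a, ∑ b ∈ Finset.univ.erase a, ∫⁻ p,
        closeIndicator ρ (p.1 (π a)) (p.1 (π b)) * errorIndicator σ e a π p.1 p.2 ∂μ :=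
          Finset.sum_congr rfl fun a _ => Finset.sum_congr rfl fun b _ =>
            h1 _ (hmce π a b)
      _ ≤ ∑ a, (∫⁻ p, errorIndicator σ e a π p.1 p.2 ∂μ + n * (n * B ^ 2)) :=
          Finset.sum_le_sum fun a _ => hb a
      _ = _ := by
          rw [Finset.sum_add_distrib, ← lintegral_finsetSum _ fun a _ => hme a π,
            ← h1 _ (Finset.measurable_sum _ fun a _ => hme a π)]
          simp
  have hsum := Finset.sum_le_sum fun (π : Equiv.Perm (Fin n)) (_ : π ∈ Finset.univ) => hπ π
  rw [Finset.sum_add_distrib, Finset.sum_const, nsmul_eq_mul, Finset.card_univ, ← hN,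
    Finset.sum_comm] at hsum
  have hlow : N * (n * ((n - 1 : ℕ) * q)) ≤ ∑ a, ∑ π : Equiv.Perm (Fin n),
      ∑ b ∈ Finset.univ.erase a, ∫⁻ X, ∫⁻ Z,
        closeIndicator ρ (X (π a)) (X (π b)) * errorIndicator σ e a π X Z
        ∂(Measure.pi fun _ => Q) ∂(Measure.pi fun _ => P) := by
    calc N * (n * ((n - 1 : ℕ) * q)) = ∑ a : Fin n, ∑ _b ∈ Finset.univ.erase a, N * q := by
          simp only [Finset.sum_const, Finset.card_erase_of_mem (Finset.mem_univ _),
            Finset.card_univ, Fintype.card_fin, nsmul_eq_mul]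
          ring
      _ ≤ _ := by
          refine Finset.sum_le_sum fun a _ => ?_
          rw [Finset.sum_comm]
          exact Finset.sum_le_sum fun b hb => hq a b (Finset.ne_of_mem_erase hb).symm
  have h := mul_le_mul_right (hlow.trans hsum) N⁻¹
  rwa [mul_add, ← mul_assoc, ← mul_assoc N⁻¹ N, ENNReal.inv_mul_cancel hN0 hNt, one_mul,
    one_mul] at h

/-- The lower bound on the risk of all estimators. -/
theorem exists_le_risk {d : ℕ} (hd : 1 ≤ d) {P Q : Measure (Pt d)} [IsProbabilityMeasure P]
    [IsProbabilityMeasure Q] (hP : HasBoundedContinuousDensity P)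
    (hQ : HasBoundedContinuousDensity Q) :
    ∃ c : ℝ, 0 < c ∧ ∀ (n : ℕ), 2 ≤ n → ∀ σ : ℝ, 0 < σ → ∀ e : Estimator n d,
      c * min ((n : ℝ) ^ 2 * σ ^ d) (n : ℝ) ≤ risk P Q σ e := by
  obtain ⟨r, κ, hr, hκ, hshift⟩ := hQ.exists_le_lintegral_add_shift
  obtain ⟨r', c, hr', hc, hclose⟩ := hP.exists_le_lintegral_closeIndicator
  obtain ⟨B, hB0, hB⟩ := hP.exists_measure_ball_le
  set γ := κ * c / 2 with hγ
  have hγ0 : 0 < γ := by positivity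
  -- The bounds `r`, `r'` permit the shift and closeness lemmas; the last bound makes the triple
  -- correction at most half of the main term.
  set s := min (min r r') (min 1 (γ / (4 * (B ^ 2 + 1)))) with hs
  have hs0 : 0 < s := lt_min (lt_min hr hr') (lt_min one_pos (by positivity))
  have hsr : s ≤ r := (min_le_left _ _).trans (min_le_left _ _)
  have hsr' : s ≤ r' := (min_le_left _ _).trans (min_le_right _ _)
  have hs1 : s ≤ 1 := (min_le_right _ _).trans (min_le_left _ _)
  have hsγ : s ≤ γ / (4 * (B ^ 2 + 1)) := (min_le_right _ _).trans (min_le_right _ _)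
  refine ⟨s ^ d * γ / 4, by positivity, fun n hn σ hσ e => ?_⟩
  have hn0 : (0 : ℝ) < n := by positivity
  have hn2 : (2 : ℝ) ≤ n := by exact_mod_cast hn
  have hd0 : d ≠ 0 := by omega
  -- With this `t`, the target rate is exactly `n² t^d`, while `n t^d ≤ 1` keeps the expected number
  -- of close neighbours bounded.
  obtain ⟨t, ht0, ht⟩ : ∃ t : ℝ, 0 < t ∧ t ^ d = min (σ ^ d) (1 / n) := by
    refine ⟨(min (σ ^ d) (1 / n)) ^ (d⁻¹ : ℝ), ?_, ?_⟩
    · exact Real.rpow_pos_of_pos (lt_min (by positivity) (by positivity)) _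
    · exact Real.rpow_inv_natCast_pow (le_min (by positivity) (by positivity)) hd0
  have htσ : t ≤ σ := (pow_le_pow_iff_left₀ ht0.le hσ.le hd0).1 (ht ▸ min_le_left _ _)
  have htn : n * t ^ d ≤ 1 := by
    have : t ^ d ≤ 1 / n := ht ▸ min_le_right _ _
    rw [le_div_iff₀ hn0] at this
    linarith
  have ht1 : t ≤ 1 := by
    refine (pow_le_pow_iff_left₀ ht0.le zero_le_one hd0).1 ?_
    rw [one_pow]
    have : 0 < t ^ d := by positivity
    nlinarith
  have hρ0 : 0 < s * t := by positivity
  have h := le_ofReal_risk_add (fun x => hB x (s * t) hρ0) e fun a b hab =>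
    card_mul_le_sum_lintegral_closeIndicator_mul hshift hκ hσ
      (mul_le_mul hsr htσ ht0.le hr.le) (fun i j hij => hclose n i j hij (s * t) hρ0
        ((mul_le_of_le_one_right hs0.le ht1).trans hsr')) e hab
  have hr0 := risk_nonneg P Q σ e
  rw [← ENNReal.ofReal_natCast n, ← ENNReal.ofReal_natCast (n - 1),
    ← ENNReal.ofReal_pow (by positivity), ← ENNReal.ofReal_mul (by positivity),
    ← ENNReal.ofReal_mul hn0.le, ← ENNReal.ofReal_mul hn0.le, ← ENNReal.ofReal_mul hn0.le,
    ← ENNReal.ofReal_mul hn0.le, ← ENNReal.ofReal_add hr0 (by positivity),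
    ENNReal.ofReal_le_ofReal_iff (by positivity), Nat.cast_sub (by omega), Nat.cast_one] at h
  set R := (s * t) ^ d with hR
  have hR0 : 0 < R := by positivity
  have hmin : min ((n : ℝ) ^ 2 * σ ^ d) n = n ^ 2 * t ^ d := by
    rw [ht, mul_min_of_nonneg _ _ (by positivity)]
    congr 1
    field_simp
  have hnR : B ^ 2 * (n * R) ≤ γ / 4 := by
    have h1 : n * R ≤ s := by
      calc n * R = s ^ d * (n * t ^ d) := by rw [hR, mul_pow]; ring
        _ ≤ s ^ d * 1 := by gcongr
        _ ≤ s := by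
          rw [mul_one]
          exact pow_le_of_le_one hs0.le hs1 hd0
    have h2 : s * (4 * (B ^ 2 + 1)) ≤ γ := (le_div_iff₀ (by positivity)).1 hsγ
    have h3 : B ^ 2 * (n * R) ≤ B ^ 2 * s := by gcongr
    linarith
  -- Here `n ≥ 2` enters, through `n - 1 ≥ n / 2`.
  have hfirst : n ^ 2 * R * (γ / 2) ≤ n * ((n - 1) * (κ * (c * R) / 2)) := by
    have : (n : ℝ) / 2 ≤ n - 1 := by linarith
    calc n ^ 2 * R * (γ / 2) = n * (n / 2 * (κ * (c * R) / 2)) := by rw [hγ]; ring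
      _ ≤ _ := by gcongr
  have hsecond : n * (n * (n * (B * R) ^ 2)) ≤ n ^ 2 * R * (γ / 4) := by
    calc n * (n * (n * (B * R) ^ 2)) = n ^ 2 * R * (B ^ 2 * (n * R)) := by ring
      _ ≤ _ := by gcongr
  have hgoal : s ^ d * γ / 4 * min ((n : ℝ) ^ 2 * σ ^ d) n = n ^ 2 * R * (γ / 4) := by
    rw [hmin, hR, mul_pow]
    ring
  rw [hgoal]
  linarith

end PlantedMatching

end

theorem proposition2p2 (d : ℕ) (hd : 1 ≤ d)
    (P Q : MeasureTheory.Measure (PlantedMatching.Pt d))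
    [MeasureTheory.IsProbabilityMeasure P] [MeasureTheory.IsProbabilityMeasure Q]
    (hP : PlantedMatching.HasBoundedContinuousDensity P)
    (hQ : PlantedMatching.HasBoundedContinuousDensity Q)
    (hQmean : PlantedMatching.IsZeroMean Q)
    (hQsub : PlantedMatching.IsSubGaussian Q) :
    ∃ c C : ℝ, 0 < c ∧ 0 < C ∧ ∃ n₀ : ℕ, ∀ n : ℕ, n₀ ≤ n → ∀ σ : ℝ, 0 < σ →
      (c * min ((n : ℝ) ^ 2 * σ ^ d) (n : ℝ) ≤ PlantedMatching.minimaxRisk P Q n σ ∧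
        PlantedMatching.minimaxRisk P Q n σ ≤ C * min ((n : ℝ) ^ 2 * σ ^ d) (n : ℝ)) ∧
      ∀ e : PlantedMatching.Estimator n d, PlantedMatching.IsLSS e →
        c * min ((n : ℝ) ^ 2 * σ ^ d) (n : ℝ) ≤ PlantedMatching.risk P Q σ e ∧
        PlantedMatching.risk P Q σ e ≤ C * min ((n : ℝ) ^ 2 * σ ^ d) (n : ℝ) := by
  obtain ⟨c, hc, hlow⟩ := PlantedMatching.exists_le_risk hd hP hQ
  obtain ⟨C, hC, hup⟩ := PlantedMatching.exists_risk_le hd hP hQsub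
  refine ⟨c, C, hc, hC, 2, fun n hn σ hσ => ⟨?_, fun e he => ⟨hlow n hn σ hσ e, hup n σ hσ e he⟩⟩⟩
  -- A least-squares estimator makes the family nonempty, as the real infimum requires, and also
  -- witnesses the minimax upper bound.
  obtain ⟨e₀, he₀⟩ := PlantedMatching.exists_isLSS n d
  have : Nonempty (PlantedMatching.Estimator n d) := ⟨e₀⟩
  refine ⟨le_ciInf fun e => hlow n hn σ hσ e, (ciInf_le ⟨0, ?_⟩ e₀).trans (hup n σ hσ e₀ he₀)⟩
  rintro _ ⟨e, rfl⟩
  exact PlantedMatching.risk_nonneg P Q σ e
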